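/- Let $\mathcal F$ be a separable complex Hausdorff locally convex linear topological space that is locally sequentially weakly compact, i.e. every bounded sequence in $\mathcal F$ has a weakly convergent subsequence. Let $\mathcal L(\mathcal F)$ be the algebra of continuous linear operators on $\mathcal F$. Let $(S,\Sigma,\mu)$ be an equicontinuous spectral measure triple: $\Sigma$ is a $\sigma$-algebra of subsets of the set $S$, and $\mu:\Sigma\to\mathcal L(\mathcal F)$ is countably additive in the weak operator topology, satisfies $\mu(S)=I$ and $\mu(A\cap B)=\mu(A)\mu(B)$ for all $A,B\in\Sigma$, and $\{\mu(A):A\in\Sigma\}$ is equicontinuous. Let $f:S\to\mathbb C$ be bounded and $\Sigma$-measurable, and let $U=\int_S f\,d\mu\in\mathcal L(\mathcal F)$ be the associated scalar-type spectral operator (the strong limit of the integrals $\int g_n\,d\mu=\sum_c c\,\mu(\{g_n=c\})$ of simple functions $g_n$ converging uniformly to $f$). Put $E(B)=\mu(f^{-1}(B))$ for Borel sets $B\subset\mathbb C$, so that $U=\int_{\mathbb C}z\,E(dz)$. The spectrum $\sigma(U)$ is the complement of the set of all $\xi\in\mathbb C$ for which $\xi I-U$ has dense image and has a continuous inverse on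 its image; an eigenvalue is a $\lambda\in\sigma(U)$ for which $\lambda I-U$ is not injective; the peripheral spectrum of $U$ is the set of all $\lambda\in\sigma(U)$ with $|\lambda|=\sup_{z\in\sigma(U)}|z|$. Let $\lambda\neq 0$ be an eigenvalue of $U$ that lies in the peripheral spectrum of $U$. Then $P_\lambda:=E(\{\lambda\})$ is a projection of $\mathcal F$ onto $N(\lambda I-U)$, and $$\lim_{n\to\infty}\frac1n\sum_{k=1}^n\lambda^{-k}U^k\psi=P_\lambda\psi\qquad\text{for every }\psi\in\mathcal F$$ in the topology of $\mathcal F$, i.e. the averages converge to $P_\lambda$ in the strong operator topology. Moreover $P_\lambda U=UP_\lambda$, and $\mathcal F=N(\lambda I-U)\oplus\overline{\operatorname{Im}(\lambda I-U)}$. -/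

import Mathlib

open Filter Topology MeasureTheory
open scoped ENNReal

noncomputable section

namespace ScalarType

section Spectrum

variable {F : Type*} [AddCommGroup F] [Module ℂ F] [TopologicalSpace F]
  [IsTopologicalAddGroup F] [ContinuousSMul ℂ F]

/-- The operator `ξ I - U`. -/
def shift (U : F →L[ℂ] F) (ξ : ℂ) : F →L[ℂ] F :=
  ξ • ContinuousLinearMap.id ℂ F - U

/-- The resolvent set: all `ξ` such that `ξ I - U` has dense image and has an inverse on its image
which is continuous. (A map is an embedding exactly if it is injective and its inverse, defined on
its image with the subspace topology, is continuous.) -/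
def resolventSet (U : F →L[ℂ] F) : Set ℂ :=
  {ξ | DenseRange (shift U ξ) ∧ IsEmbedding (shift U ξ)}

/-- The spectrum `σ(U)`: the complement of the resolvent set. -/
def spectrum (U : F →L[ℂ] F) : Set ℂ := (resolventSet U)ᶜ

/-- The point spectrum `σ_p(U)`: all `ξ ∈ σ(U)` for which `ξ I - U` is not injective. -/
def pointSpectrum (U : F →L[ℂ] F) : Set ℂ :=
  {ξ | ξ ∈ spectrum U ∧ ¬ Function.Injective (shift U ξ)}

/-- The spectral radius `sup {|z| : z ∈ Λ}` of a set `Λ` of complex numbers, as an element of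
`[0, ∞]`. -/
def radius (Λ : Set ℂ) : ℝ≥0∞ := ⨆ z ∈ Λ, ‖z‖ₑ

/-- The peripheral spectrum: the elements of `σ(U)` whose modulus equals the spectral radius. -/
def peripheralSpectrum (U : F →L[ℂ] F) : Set ℂ :=
  {ξ | ξ ∈ spectrum U ∧ ‖ξ‖ₑ = radius (spectrum U)}

/-- The averages `n⁻¹ ∑_{k=1}^n lam^{-k} U^k`. -/
def average (U : F →L[ℂ] F) (lam : ℂ) (n : ℕ) : F →L[ℂ] F :=
  (n : ℂ)⁻¹ • ∑ k ∈ Finset.Icc 1 n, (lam ^ k)⁻¹ • U ^ k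

end Spectrum

/-- Local sequential weak compactness: every bounded sequence has a weakly convergent subsequence.
-/
def LocallySeqWeaklyCompact (F : Type*) [AddCommGroup F] [Module ℂ F] [TopologicalSpace F] :
    Prop :=
  ∀ u : ℕ → F, Bornology.IsVonNBounded ℂ (Set.range u) →
    ∃ x : F, ∃ k : ℕ → ℕ, StrictMono k ∧
      ∀ φ : F →L[ℂ] ℂ, Tendsto (fun n => φ (u (k n))) atTop (𝓝 (φ x))

section SpectralMeasure

variable {S F : Type*} [MeasurableSpace S] [AddCommGroup F] [Module ℂ F] [TopologicalSpace F]

/-- `(S, Σ, μ)` is a spectral measure triple, `Σ` being the σ-algebra of measurable subsets of `S`.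
Only the values of `μ` on measurable sets matter. -/
structure IsSpectralMeasure (μ : Set S → F →L[ℂ] F) : Prop where
  /-- countable additivity in the weak operator topology -/
  weak_iUnion : ∀ A : ℕ → Set S, (∀ n, MeasurableSet (A n)) →
    (∀ i j, i ≠ j → Disjoint (A i) (A j)) →
    ∀ (x : F) (φ : F →L[ℂ] ℂ), HasSum (fun n => φ (μ (A n) x)) (φ (μ (⋃ n, A n) x))
  univ : μ Set.univ = ContinuousLinearMap.id ℂ F
  inter : ∀ A B : Set S, MeasurableSet A → MeasurableSet B → μ (A ∩ B) = (μ A).comp (μ B)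

/-- The operators `μ A`, `A` measurable, form an equicontinuous family. -/
def IsEquicontinuous (μ : Set S → F →L[ℂ] F) : Prop :=
  ∀ p : Seminorm ℂ F, Continuous p → ∃ q : Seminorm ℂ F, Continuous q ∧
    ∀ A : Set S, MeasurableSet A → ∀ x : F, p (μ A x) ≤ q x

variable [IsTopologicalAddGroup F] [ContinuousSMul ℂ F]

/-- The integral of a simple function `g = ∑ c 1_{g = c}`, namely `∑ c μ(g = c)`. -/
def simpleIntegral (μ : Set S → F →L[ℂ] F) (g : SimpleFunc S ℂ) : F →L[ℂ] F :=
  ∑ c ∈ g.range, c • μ (g ⁻¹' {c})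

/-- `U = ∫ f dμ`: the operator `U` is the strong limit of the integrals of simple functions which
converge uniformly to `f`. For a bounded measurable `f`, an equicontinuous spectral measure `μ` and
a sequentially complete `F`, there is exactly one such `U`, and it does not depend on the choice of
the simple functions. -/
def IsIntegral (μ : Set S → F →L[ℂ] F) (f : S → ℂ) (U : F →L[ℂ] F) : Prop :=
  ∃ g : ℕ → SimpleFunc S ℂ, TendstoUniformly (fun n s => g n s) f atTop ∧
    ∀ x : F, Tendsto (fun n => simpleIntegral μ (g n) x) atTop (𝓝 (U x))

/-- The image measure `E = μ ∘ f⁻¹` on the Borel sets of `ℂ`, for which `∫ f dμ = ∫ z E(dz)`. -/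
def imageMeasure (μ : Set S → F →L[ℂ] F) (f : S → ℂ) (B : Set ℂ) : F →L[ℂ] F :=
  μ (f ⁻¹' B)

end SpectralMeasure

end ScalarType

end

open scoped NNReal

namespace ScalarType

/-! This is a mean ergodic theorem. The averages fix `N(λI - U)` and tend to 0 on the closure of
`Im(λI - U)` once `λ⁻¹U` is power bounded. It remains to see that `E({λ})` maps into the former,
that `E({λ}ᶜ)` maps into the latter, and that power boundedness holds.

The last two rest on one vanishing principle, `IsIntegral.apply_preimage_eq_zero`. On `E(B)F` with
`B` in a disc of radius `ε` about `ξ`, the operator `(ξI - U)³` is `O(ε³)`. If `φ` is dominated by a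
continuous seminorm of `(ξI - U)³`, then `B ↦ φ(E(B)x)` is `O(ε³)` on such `B`, which is negligible
against the area `πε²`. A measure with this property at every point of `A` vanishes on `A`, by
Besicovitch differentiation; no uniformity in `ξ` is needed.

At resolvent points every `φ` is so dominated, so `E` lives on `|z| ≤ |λ|` and `‖λ‖⁻ⁿUⁿ` is
equicontinuous. A `φ` that annihilates `Im(λI - U)` is an eigenvector of the transpose, hence
dominated at every `ξ ≠ λ`; Hahn–Banach then handles `E({λ}ᶜ)`. -/

theorem continuous_finset_sup_seminorm {F : Type*} [AddCommGroup F] [Module ℂ F]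
    [TopologicalSpace F] {ι : Type*} (p : ι → Seminorm ℂ F)
    (hp : ∀ i, Continuous (p i)) (s : Finset ι) :
    Continuous (s.sup p : Seminorm ℂ F) := by
  classical
  induction s using Finset.induction_on with
  | empty => exact continuous_const (y := (0 : ℝ))
  | insert a s _ ih =>
    rw [Finset.sup_insert]
    exact (hp a).max ih

/-! ### Seminorms and Hahn–Banach in a complex locally convex space -/

section LocallyConvex

variable {F : Type*} [AddCommGroup F] [Module ℂ F] [TopologicalSpace F]
  [IsTopologicalAddGroup F] [ContinuousSMul ℂ F] [LocallyConvexSpace ℝ F]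

theorem polynormableSpace_complex : PolynormableSpace ℂ F := by
  open scoped ComplexOrder in
  have h : LocallyConvexSpace ℂ F := by
    refine LocallyConvexSpace.ofBasisZero ℂ F _ _
      (LocallyConvexSpace.convex_basis_zero ℝ F) fun s hs => ?_
    exact convex_of_nonneg_surjective_algebraMap _
      (fun z hz => by
        obtain ⟨x, hx, rfl⟩ := RCLike.nonneg_iff_exists_ofReal.mp (Set.mem_Ici.1 hz)
        exact ⟨x, hx, rfl⟩) hs.2
  have := IsScalarTower.continuousSMul (M := ℝ) (α := F) ℂ
  exact LocallyConvexSpace.toPolynormableSpace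

theorem tendsto_of_forall_seminorm {ι : Type*} {l : Filter ι} {u : ι → F} {x : F}
    (h : ∀ p : Seminorm ℂ F, Continuous p → Tendsto (fun i => p (u i - x)) l (𝓝 0)) :
    Tendsto u l (𝓝 x) := by
  have := polynormableSpace_complex (F := F)
  rw [(PolynormableSpace.withSeminorms ℂ F).tendsto_nhds]
  rintro ⟨p, hp⟩ ε hε
  exact (h p hp).eventually_lt_const hε

theorem eq_zero_of_forall_seminorm [T2Space F] {x : F}
    (h : ∀ p : Seminorm ℂ F, Continuous p → p x = 0) : x = 0 := by
  have h1 : Tendsto (fun _ : ℕ => (0 : F)) atTop (𝓝 x) :=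
    tendsto_of_forall_seminorm fun p hp => by simp [h p hp]
  exact tendsto_nhds_unique h1 tendsto_const_nhds

/-- Continuity of the inverse on the image, in terms of seminorms. -/
theorem exists_seminorm_le_comp_of_isInducing {T : F →L[ℂ] F} (hT : IsInducing T)
    {p : Seminorm ℂ F} (hp : Continuous p) :
    ∃ q : Seminorm ℂ F, Continuous q ∧ ∀ x, p x ≤ q (T x) := by
  have := polynormableSpace_complex (F := F)
  have hball : {x | p x < 1} ∈ 𝓝 (0 : F) :=
    (isOpen_lt hp continuous_const).mem_nhds (by simp)
  rw [hT.nhds_eq_comap, map_zero, mem_comap] at hball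
  obtain ⟨V, hV, hVp⟩ := hball
  rw [(PolynormableSpace.withSeminorms ℂ F).mem_nhds_iff] at hV
  obtain ⟨s, r, hr, hs⟩ := hV
  set Q := s.sup fun p : {p : Seminorm ℂ F // Continuous p} ↦ p.1
  have hQ : Continuous Q := continuous_finset_sup_seminorm _ (fun i => i.2) s
  have key : ∀ x, Q (T x) < r → p x < 1 := fun x hx => hVp (hs (by simpa using hx))
  refine ⟨(NNReal.mk r⁻¹ (by positivity) : ℝ≥0) • Q, hQ.const_smul _, fun x => ?_⟩
  change p x ≤ r⁻¹ * Q (T x)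
  -- The extra `ε` keeps the scaling factor `a` positive even when `Q (T x) = 0`.
  refine le_of_forall_pos_lt_add fun ε hε => ?_
  have hpos : 0 < r⁻¹ * Q (T x) + ε :=
    add_pos_of_nonneg_of_pos (mul_nonneg (by positivity) (apply_nonneg _ _)) hε
  set a := r⁻¹ * Q (T x) + ε with ha
  have h1 := key (((a⁻¹ : ℝ) : ℂ) • x) (by
    rw [map_smul, map_smul_eq_mul, Complex.norm_real, Real.norm_of_nonneg (by positivity),
      inv_mul_lt_iff₀ hpos, ha, add_mul, mul_comm r⁻¹, inv_mul_cancel_right₀ hr.ne']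
    linarith [mul_pos hε hr])
  rwa [map_smul_eq_mul, Complex.norm_real, Real.norm_of_nonneg (by positivity),
      inv_mul_lt_iff₀ hpos, mul_one] at h1

theorem eq_zero_of_forall_dual [T2Space F] {x : F} (h : ∀ φ : F →L[ℂ] ℂ, φ x = 0) : x = 0 := by
  by_contra hx
  obtain ⟨φ, hφ⟩ := RCLike.geometric_hahn_banach_point_point (𝕜 := ℂ) hx
  simp [h φ] at hφ

theorem mem_topologicalClosure_of_forall_dual {N : Submodule ℂ F} {x : F}
    (h : ∀ φ : F →L[ℂ] ℂ, (∀ y ∈ N, φ y = 0) → φ x = 0) : x ∈ N.topologicalClosure := by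
  by_contra hx
  obtain ⟨φ, u, h1, h2⟩ := RCLike.geometric_hahn_banach_closed_point (𝕜 := ℂ)
    (s := (N.topologicalClosure : Set F)) (x := x)
    (N.topologicalClosure.restrictScalars ℝ).convex N.isClosed_topologicalClosure hx
  have hu : 0 < u := by simpa using h1 0 (zero_mem _)
  have h3 : φ x = 0 := by
    refine h φ fun y hy => ?_
    by_contra hne
    -- This multiple of `y` has `φ`-value exactly `u`, against the strict bound on the subspace.
    have h4 := h1 (((u : ℂ) / φ y) • y)
      (N.le_topologicalClosure (N.smul_mem _ hy))
    rw [map_smul, smul_eq_mul, div_mul_cancel₀ _ hne] at h4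
    simp at h4
  rw [h3] at h2
  simp at h2
  linarith

end LocallyConvex

/-! ### Bounding linear combinations by subset sums -/

section Combination

variable {F : Type*} [AddCommGroup F] [Module ℂ F] {ι : Type*}

/-- A convex function on the cube `[0,1]^s` is bounded by its values at the vertices, which are the
subset sums. The offset `w` absorbs coordinates already set to 0 or 1. -/
theorem seminorm_add_sum_smul_le (p : Seminorm ℂ F) (v : ι → F) {K : ℝ} (c : ι → ℝ)
    (s : Finset ι) (hc : ∀ i ∈ s, 0 ≤ c i ∧ c i ≤ 1) (w : F)
    (h : ∀ t ⊆ s, p (w + ∑ i ∈ t, v i) ≤ K) :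
    p (w + ∑ i ∈ s, (c i : ℂ) • v i) ≤ K := by
  classical
  induction s using Finset.induction_on generalizing w with
  | empty => simpa using h ∅
  | insert a s ha ih =>
    have hc' : ∀ i ∈ s, 0 ≤ c i ∧ c i ≤ 1 := fun i hi => hc i (Finset.mem_insert_of_mem hi)
    obtain ⟨h0, h1⟩ := hc a (Finset.mem_insert_self _ _)
    have e1 := ih hc' w fun t ht => h t (ht.trans (Finset.subset_insert _ _))
    have e2 := ih hc' (w + v a) fun t ht => by
      have := h (insert a t) (Finset.insert_subset_insert _ ht)
      rwa [Finset.sum_insert (fun hat => ha (ht hat)), ← add_assoc] at this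
    rw [Finset.sum_insert ha]
    set z := ∑ i ∈ s, (c i : ℂ) • v i
    have : w + ((c a : ℂ) • v a + z)
        = ((1 - c a : ℝ) : ℂ) • (w + z) + (c a : ℂ) • (w + v a + z) := by
      push_cast
      module
    rw [this]
    refine (map_add_le_add p _ _).trans ?_
    rw [map_smul_eq_mul, map_smul_eq_mul, Complex.norm_real, Complex.norm_real,
      Real.norm_of_nonneg h0, Real.norm_of_nonneg (by linarith)]
    nlinarith

/-- The factor 4 counts the positive and negative parts of the real and imaginary parts of `c`. -/
theorem seminorm_sum_smul_le (p : Seminorm ℂ F) (v : ι → F) {K M : ℝ} (hM : 0 ≤ M) (c : ι → ℂ)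
    (s : Finset ι) (hc : ∀ i ∈ s, ‖c i‖ ≤ M) (h : ∀ t ⊆ s, p (∑ i ∈ t, v i) ≤ K) :
    p (∑ i ∈ s, c i • v i) ≤ 4 * M * K := by
  rcases hM.eq_or_lt with rfl | hM
  · rw [Finset.sum_eq_zero fun i hi => by
      rw [norm_le_zero_iff.1 (hc i hi), zero_smul]]
    simp
  have key : ∀ d : ι → ℝ, (∀ i ∈ s, d i ≤ M) →
      p (∑ i ∈ s, ((max (d i) 0 / M : ℝ) : ℂ) • v i) ≤ K := fun d hd => by
    have := seminorm_add_sum_smul_le p v (K := K) (fun i => max (d i) 0 / M) s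
      (fun i hi => ⟨by positivity, (div_le_one hM).2 (max_le (hd i hi) hM.le)⟩) 0
      (by simpa using h)
    simpa using this
  have hre : ∀ i ∈ s, |(c i).re| ≤ M := fun i hi => (Complex.abs_re_le_norm _).trans (hc i hi)
  have him : ∀ i ∈ s, |(c i).im| ≤ M := fun i hi => (Complex.abs_im_le_norm _).trans (hc i hi)
  have k1 := key (fun i => (c i).re) fun i hi => (abs_le.1 (hre i hi)).2
  have k2 := key (fun i => -(c i).re) fun i hi => by linarith [(abs_le.1 (hre i hi)).1]
  have k3 := key (fun i => (c i).im) fun i hi => (abs_le.1 (him i hi)).2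
  have k4 := key (fun i => -(c i).im) fun i hi => by linarith [(abs_le.1 (him i hi)).1]
  set s1 := ∑ i ∈ s, ((max (c i).re 0 / M : ℝ) : ℂ) • v i with hs1
  set s2 := ∑ i ∈ s, ((max (-(c i).re) 0 / M : ℝ) : ℂ) • v i with hs2
  set s3 := ∑ i ∈ s, ((max (c i).im 0 / M : ℝ) : ℂ) • v i with hs3
  set s4 := ∑ i ∈ s, ((max (-(c i).im) 0 / M : ℝ) : ℂ) • v i with hs4
  have e : ∑ i ∈ s, c i • v i = (M : ℂ) • ((s1 - s2) + Complex.I • (s3 - s4)) := by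
    rw [hs1, hs2, hs3, hs4, ← Finset.sum_sub_distrib, ← Finset.sum_sub_distrib, Finset.smul_sum,
      ← Finset.sum_add_distrib, Finset.smul_sum]
    refine Finset.sum_congr rfl fun i _ => ?_
    rw [← sub_smul, ← sub_smul, smul_smul, ← add_smul, smul_smul]
    congr 1
    have hm : ∀ r : ℝ, max r 0 - max (-r) 0 = r := fun r => by
      rcases le_total 0 r with hr | hr <;> simp [hr]
    have hM' : (M : ℂ) ≠ 0 := by exact_mod_cast hM.ne'
    rw [← Complex.ofReal_sub, ← Complex.ofReal_sub, ← sub_div, ← sub_div, hm, hm]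
    conv_lhs => rw [← Complex.re_add_im (c i)]
    push_cast
    field_simp
  rw [e, map_smul_eq_mul, Complex.norm_real, Real.norm_of_nonneg hM.le]
  have t1 := map_add_le_add p (s1 - s2) (Complex.I • (s3 - s4))
  have t2 := map_sub_le_add p s1 s2
  have t3 := map_sub_le_add p s3 s4
  rw [map_smul_eq_mul, Complex.norm_I, one_mul] at t1
  nlinarith

end Combination

/-! ### Measures of vanishing planar density -/

section Density

/-- For every `c > 0`, small discs about points of `A` have positive part at most `c` times their
area, so Besicovitch covering gives `ν A ≤ c * volume A`; let `c → 0`. The hypothesis covers all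
Borel subsets of a disc because `ν` of the disc is `s` of its intersection with `i`. -/
theorem signedMeasure_inter_eq_zero_of_density (s : SignedMeasure ℂ) {i A : Set ℂ}
    (hi : MeasurableSet i) (hpos : VectorMeasure.restrict 0 i ≤ VectorMeasure.restrict s i)
    (hA : MeasurableSet A) (hvol : volume A ≠ ∞)
    (h : ∀ ξ ∈ A, ∃ C : ℝ, ∀ ε > 0, ∀ B ⊆ Metric.closedBall ξ ε, MeasurableSet B →
      |s B| ≤ C * ε ^ 3) : s (i ∩ A) = 0 := by
  set ν := s.toMeasureOfZeroLE i hi hpos with hν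
  have hνr : ∀ B, MeasurableSet B → ν.real B = s (i ∩ B) := fun B hB =>
    s.toMeasureOfZeroLE_real_apply hpos hi hB
  have key : ∀ c : ℝ≥0, 0 < c → ν A ≤ c * volume A := by
    intro c hc
    have := (Besicovitch.vitaliFamily ν).measure_le_of_frequently_le (c • volume)
      Measure.AbsolutelyContinuous.rfl A fun ξ hξ => by
        refine (Besicovitch.tendsto_filterAt ν ξ).frequently (Eventually.frequently ?_)
        obtain ⟨C, hC⟩ := h ξ hξ
        have h0 : Tendsto (fun ε : ℝ => C * ε) (𝓝[>] 0) (𝓝 0) := by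
          have : Tendsto (fun ε : ℝ => C * ε) (𝓝 0) (𝓝 (C * 0)) :=
            tendsto_id.const_mul C
          rw [mul_zero] at this
          exact this.mono_left nhdsWithin_le_nhds
        filter_upwards [h0.eventually_lt_const (show (0 : ℝ) < c by exact_mod_cast hc),
          self_mem_nhdsWithin] with ε h1 hε
        have hε' : (0 : ℝ) < ε := hε
        have hb := hC ε hε (i ∩ Metric.closedBall ξ ε) Set.inter_subset_right
          (hi.inter measurableSet_closedBall)
        have e1 : ν (Metric.closedBall ξ ε) ≤ ENNReal.ofReal (c * ε ^ 2) := by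
          rw [← ofReal_measureReal, hνr _ measurableSet_closedBall]
          refine ENNReal.ofReal_le_ofReal ((le_abs_self _).trans (hb.trans ?_))
          nlinarith [sq_nonneg ε]
        refine e1.trans ?_
        rw [Measure.smul_apply, Complex.volume_closedBall, ENNReal.ofReal_mul (by positivity),
          ENNReal.ofReal_pow hε'.le, ENNReal.ofReal_coe_nnreal, ENNReal.smul_def, smul_eq_mul]
        gcongr
        refine le_mul_of_one_le_right zero_le ?_
        have := Real.pi_gt_three
        have h2 : (1 : ℝ≥0) ≤ NNReal.pi := by
          rw [← NNReal.coe_le_coe]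
          simp only [NNReal.coe_one, NNReal.coe_real_pi]
          linarith
        exact_mod_cast h2
    rwa [Measure.smul_apply, ENNReal.smul_def, smul_eq_mul] at this
  have h0 : ν A = 0 := by
    have ht : Tendsto (fun n : ℕ => (((n : ℝ≥0) + 1)⁻¹ : ℝ≥0) * volume A) atTop
        (𝓝 (0 * volume A)) := by
      refine ENNReal.Tendsto.mul_const ?_ (Or.inr hvol)
      have : Tendsto (fun n : ℕ => ((n : ℝ≥0) + 1)⁻¹) atTop (𝓝 0) := by
        simpa [one_div] using tendsto_one_div_add_atTop_nhds_zero_nat (𝕜 := ℝ≥0)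
      exact ENNReal.tendsto_coe.2 this
    rw [zero_mul] at ht
    exact le_antisymm (ge_of_tendsto' ht fun n => key _ (by positivity)) zero_le
  rw [← hνr A hA, measureReal_def, h0]
  simp

theorem signedMeasure_eq_zero_of_density (s : SignedMeasure ℂ) {A : Set ℂ}
    (hA : MeasurableSet A) (hvol : volume A ≠ ∞)
    (h : ∀ ξ ∈ A, ∃ C : ℝ, ∀ ε > 0, ∀ B ⊆ Metric.closedBall ξ ε, MeasurableSet B →
      |s B| ≤ C * ε ^ 3) : s A = 0 := by
  obtain ⟨i, hi, hpos, hneg⟩ := s.exists_compl_positive_negative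
  have h1 := signedMeasure_inter_eq_zero_of_density s hi hpos hA hvol h
  have h2 := signedMeasure_inter_eq_zero_of_density (-s) hi.compl
    (@neg_zero (VectorMeasure ℂ ℝ) _ ▸ VectorMeasure.neg_le_neg _ _ hi.compl hneg) hA hvol
    (by simpa using h)
  rw [neg_apply, neg_eq_zero] at h2
  rw [← Set.inter_union_compl A i, VectorMeasure.of_union
    (disjoint_compl_right.mono Set.inter_subset_right Set.inter_subset_right)
    (hA.inter hi) (hA.inter hi.compl), Set.inter_comm, h1, Set.inter_comm, h2, add_zero]

end Density

end ScalarType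

namespace ScalarType

/-! ### Spectral measures, integrals and norm-type estimates -/

section SpectralMeasure

variable {S F : Type*} [MeasurableSpace S] [AddCommGroup F] [Module ℂ F] [TopologicalSpace F]
  {μ : Set S → F →L[ℂ] F}

theorem IsSpectralMeasure.apply_apply (hμ : IsSpectralMeasure μ) {A B : Set S}
    (hA : MeasurableSet A) (hB : MeasurableSet B) (x : F) : μ A (μ B x) = μ (A ∩ B) x := by
  rw [hμ.inter A B hA hB]
  rfl

variable [IsTopologicalAddGroup F] [ContinuousSMul ℂ F]

theorem simpleIntegral_apply (μ : Set S → F →L[ℂ] F) (g : SimpleFunc S ℂ) (x : F) :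
    simpleIntegral μ g x = ∑ c ∈ g.range, c • μ (g ⁻¹' {c}) x := by
  simp [simpleIntegral]

theorem shift_apply (U : F →L[ℂ] F) (ξ : ℂ) (x : F) : shift U ξ x = ξ • x - U x := rfl

theorem IsSpectralMeasure.simpleIntegral_comm (hμ : IsSpectralMeasure μ) (g : SimpleFunc S ℂ)
    {B : Set S} (hB : MeasurableSet B) (x : F) :
    simpleIntegral μ g (μ B x) = μ B (simpleIntegral μ g x) := by
  simp only [simpleIntegral_apply, map_sum, map_smul]
  refine Finset.sum_congr rfl fun c _ => ?_
  rw [hμ.apply_apply (g.measurableSet_fiber c) hB, hμ.apply_apply hB (g.measurableSet_fiber c),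
    Set.inter_comm]

variable [LocallyConvexSpace ℝ F] [T2Space F]

theorem IsSpectralMeasure.apply_empty (hμ : IsSpectralMeasure μ) : μ ∅ = 0 := by
  ext x
  refine eq_zero_of_forall_dual fun φ => ?_
  -- A summable constant sequence is zero.
  have h := hμ.weak_iUnion (fun _ => ∅) (fun _ => MeasurableSet.empty) (fun _ _ _ => by simp) x φ
  exact tendsto_nhds_unique tendsto_const_nhds h.summable.tendsto_atTop_zero

theorem IsSpectralMeasure.apply_union (hμ : IsSpectralMeasure μ) {A B : Set S}
    (hA : MeasurableSet A) (hB : MeasurableSet B) (hAB : Disjoint A B) :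
    μ (A ∪ B) = μ A + μ B := by
  ext x
  rw [← sub_eq_zero]
  refine eq_zero_of_forall_dual fun φ => ?_
  set G : ℕ → Set S := fun n => if n = 0 then A else if n = 1 then B else ∅ with hG
  have h := hμ.weak_iUnion G (fun n => by simp only [hG]; split_ifs <;> simp [hA, hB])
    (fun i j hij => by
      simp only [hG]
      split_ifs <;> simp_all [disjoint_comm]) x φ
  have hU : ⋃ n, G n = A ∪ B := by
    ext s
    simp only [Set.mem_iUnion, Set.mem_union]
    constructor
    · rintro ⟨n, hn⟩
      simp only [hG] at hn
      split_ifs at hn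
      · exact Or.inl hn
      · exact Or.inr hn
      · exact hn.elim
    · rintro (hs | hs)
      · exact ⟨0, by simpa [hG] using hs⟩
      · exact ⟨1, by simpa [hG] using hs⟩
  have h2 : HasSum (fun n => φ (μ (G n) x)) (∑ n ∈ Finset.range 2, φ (μ (G n) x)) := by
    refine hasSum_sum_of_ne_finset_zero fun n hn => ?_
    have : ¬ n < 2 := by simpa using hn
    simp only [hG]
    rw [if_neg (by omega), if_neg (by omega), hμ.apply_empty]
    simp
  have h3 := h.unique h2
  rw [hU] at h3
  simp [Finset.sum_range_succ, hG] at h3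
  simp [h3]

theorem IsSpectralMeasure.sum_fiber (hμ : IsSpectralMeasure μ) (g : SimpleFunc S ℂ) {B : Set S}
    (hB : MeasurableSet B) (t : Finset ℂ) :
    ∑ c ∈ t, μ (g ⁻¹' {c} ∩ B) = μ (g ⁻¹' (t : Set ℂ) ∩ B) := by
  classical
  induction t using Finset.induction_on with
  | empty => simp [hμ.apply_empty]
  | insert a t ha ih =>
    rw [Finset.sum_insert ha, ih, ← hμ.apply_union ((g.measurableSet_preimage _).inter hB)
      ((g.measurableSet_preimage _).inter hB), ← Set.union_inter_distrib_right,
      ← Set.preimage_union]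
    · rw [Finset.coe_insert, Set.insert_eq]
    · refine Disjoint.mono Set.inter_subset_left Set.inter_subset_left ?_
      refine Disjoint.preimage _ ?_
      simpa using ha

theorem IsSpectralMeasure.sum_range (hμ : IsSpectralMeasure μ) (g : SimpleFunc S ℂ) :
    ∑ c ∈ g.range, μ (g ⁻¹' {c}) = ContinuousLinearMap.id ℂ F := by
  have := hμ.sum_fiber g MeasurableSet.univ g.range
  simp only [Set.inter_univ] at this
  rw [this, ← hμ.univ]
  congr 1
  ext s
  simp

/-- Values not taken on `B` carry no mass, so their weights may be set to 0; the subset sums are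
then `μ B' x` with `B' ⊆ B`. -/
theorem IsSpectralMeasure.seminorm_sum_fiber_le (hμ : IsSpectralMeasure μ) (g : SimpleFunc S ℂ)
    {B : Set S} (hB : MeasurableSet B) (w : ℂ → ℂ) {M K : ℝ} (hM : 0 ≤ M)
    (hw : ∀ s ∈ B, ‖w (g s)‖ ≤ M) (p : Seminorm ℂ F) {x : F}
    (hK : ∀ B' ⊆ B, MeasurableSet B' → p (μ B' x) ≤ K) :
    p (∑ c ∈ g.range, w c • μ (g ⁻¹' {c}) (μ B x)) ≤ 4 * M * K := by
  classical
  have e : ∑ c ∈ g.range, w c • μ (g ⁻¹' {c}) (μ B x) =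
      ∑ c ∈ g.range, (if (g ⁻¹' {c} ∩ B).Nonempty then w c else 0) • μ (g ⁻¹' {c} ∩ B) x := by
    refine Finset.sum_congr rfl fun c _ => ?_
    rw [hμ.apply_apply (g.measurableSet_fiber c) hB]
    split_ifs with h
    · rfl
    · rw [Set.not_nonempty_iff_eq_empty.1 h, hμ.apply_empty]
      simp
  rw [e]
  refine seminorm_sum_smul_le p _ hM _ _ (fun c _ => ?_) fun t _ => ?_
  · split_ifs with h
    · obtain ⟨s, hs, hsB⟩ := h
      have hs' : g s = c := hs
      exact hs' ▸ hw s hsB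
    · simpa using hM
  · have := congrArg (fun T : F →L[ℂ] F => T x) (hμ.sum_fiber g hB t)
    simp only [sum_apply] at this
    rw [this]
    exact hK _ Set.inter_subset_right ((g.measurableSet_preimage _).inter hB)

theorem IsSpectralMeasure.simpleIntegral_apply_fiber (hμ : IsSpectralMeasure μ)
    (g : SimpleFunc S ℂ) {c : ℂ} (hc : c ∈ g.range) (x : F) :
    simpleIntegral μ g (μ (g ⁻¹' {c}) x) = c • μ (g ⁻¹' {c}) x := by
  classical
  rw [simpleIntegral_apply, Finset.sum_eq_single_of_mem c hc]
  · rw [hμ.apply_apply (g.measurableSet_fiber c) (g.measurableSet_fiber c), Set.inter_self]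
  · intro d _ hdc
    rw [hμ.apply_apply (g.measurableSet_fiber d) (g.measurableSet_fiber c), ← Set.preimage_inter,
      Set.singleton_inter_eq_empty.2 (by simpa using hdc), Set.preimage_empty, hμ.apply_empty]
    simp

theorem IsSpectralMeasure.simpleIntegral_pow_apply (hμ : IsSpectralMeasure μ)
    (g : SimpleFunc S ℂ) (n : ℕ) (x : F) :
    (simpleIntegral μ g ^ n) x = ∑ c ∈ g.range, c ^ n • μ (g ⁻¹' {c}) x := by
  induction n with
  | zero =>
    have := congrArg (fun T : F →L[ℂ] F => T x) (hμ.sum_range g)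
    simp only [sum_apply] at this
    simp [this]
  | succ n ih =>
    rw [pow_succ', mul_apply_eq_comp, ih, map_sum]
    refine Finset.sum_congr rfl fun c hc => ?_
    rw [map_smul, hμ.simpleIntegral_apply_fiber g hc, smul_smul, pow_succ]

variable {f : S → ℂ} {U : F →L[ℂ] F}

theorem IsIntegral.comm (hU : IsIntegral μ f U) (hμ : IsSpectralMeasure μ)
    {B : Set S} (hB : MeasurableSet B) (x : F) : U (μ B x) = μ B (U x) := by
  obtain ⟨g, -, hg⟩ := hU
  refine tendsto_nhds_unique (hg (μ B x)) ?_
  simp only [hμ.simpleIntegral_comm _ hB]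
  exact ((μ B).continuous.tendsto _).comp (hg x)

theorem IsIntegral.shift_pow_comm (hU : IsIntegral μ f U) (hμ : IsSpectralMeasure μ) (ξ : ℂ)
    {B : Set S} (hB : MeasurableSet B) (k : ℕ) (x : F) :
    (shift U ξ ^ k) (μ B x) = μ B ((shift U ξ ^ k) x) := by
  induction k generalizing x with
  | zero => simp
  | succ k ih =>
    rw [pow_succ, mul_apply_eq_comp, mul_apply_eq_comp, ← ih]
    simp [shift_apply, hU.comm hμ hB]

theorem IsIntegral.seminorm_shift_le (hU : IsIntegral μ f U) (hμ : IsSpectralMeasure μ)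
    {B : Set S} (hB : MeasurableSet B) {ξ : ℂ} {ε K : ℝ} (hε : 0 ≤ ε)
    (hf : ∀ s ∈ B, ‖ξ - f s‖ ≤ ε) {p : Seminorm ℂ F} (hp : Continuous p) {x : F}
    (hK : ∀ B' ⊆ B, MeasurableSet B' → p (μ B' x) ≤ K) :
    p (shift U ξ (μ B x)) ≤ 4 * ε * K := by
  obtain ⟨g, hgf, hg⟩ := hU
  have hlim : Tendsto (fun n => p (ξ • μ B x - simpleIntegral μ (g n) (μ B x))) atTop
      (𝓝 (p (shift U ξ (μ B x)))) :=
    (hp.tendsto _).comp (tendsto_const_nhds.sub (hg (μ B x)))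
  have hbound : ∀ δ > 0, p (shift U ξ (μ B x)) ≤ 4 * (ε + δ) * K := fun δ hδ => by
    refine le_of_tendsto hlim ?_
    filter_upwards [Metric.tendstoUniformly_iff.1 hgf δ hδ] with n hn
    have e : ξ • μ B x - simpleIntegral μ (g n) (μ B x) =
        ∑ c ∈ (g n).range, (ξ - c) • μ (g n ⁻¹' {c}) (μ B x) := by
      have := congrArg (fun T : F →L[ℂ] F => T (μ B x)) (hμ.sum_range (g n))
      simp only [sum_apply, ContinuousLinearMap.id_apply] at this
      simp only [sub_smul, Finset.sum_sub_distrib, ← Finset.smul_sum, this, simpleIntegral_apply]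
    rw [e]
    refine hμ.seminorm_sum_fiber_le (g n) hB (fun c => ξ - c) (by positivity) (fun s hs => ?_) p hK
    have h1 := hn s
    rw [dist_eq_norm] at h1
    calc ‖ξ - g n s‖ = ‖(ξ - f s) + (f s - g n s)‖ := by congr 1; ring
      _ ≤ ε + δ := (norm_add_le _ _).trans (add_le_add (hf s hs) h1.le)
  have hlim2 : Tendsto (fun δ : ℝ => 4 * (ε + δ) * K) (𝓝[>] 0) (𝓝 (4 * ε * K)) := by
    have : Tendsto (fun δ : ℝ => 4 * (ε + δ) * K) (𝓝 0) (𝓝 (4 * (ε + 0) * K)) :=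
      Continuous.tendsto (by fun_prop) 0
    rw [add_zero] at this
    exact this.mono_left nhdsWithin_le_nhds
  refine ge_of_tendsto hlim2 ?_
  filter_upwards [self_mem_nhdsWithin] with δ hδ using hbound δ hδ

theorem IsIntegral.seminorm_shift_pow_le (hU : IsIntegral μ f U) (hμ : IsSpectralMeasure μ)
    {ξ : ℂ} {ε K : ℝ} (hε : 0 ≤ ε) {p : Seminorm ℂ F} (hp : Continuous p) {x : F}
    (hK : ∀ B, MeasurableSet B → p (μ B x) ≤ K) (k : ℕ) {B : Set S} (hB : MeasurableSet B)
    (hf : ∀ s ∈ B, ‖ξ - f s‖ ≤ ε) :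
    p ((shift U ξ ^ k) (μ B x)) ≤ (4 * ε) ^ k * K := by
  induction k generalizing B with
  | zero => simpa using hK B hB
  | succ k ih =>
    -- The one-step estimate is applied to the vector `(shift U ξ ^ k) x`; the induction hypothesis
    -- on subsets of `B` supplies its constant.
    rw [pow_succ', mul_apply_eq_comp, hU.shift_pow_comm hμ ξ hB, pow_succ', mul_assoc]
    refine hU.seminorm_shift_le hμ hB hε hf hp fun B' hB' hB'm => ?_
    rw [← hU.shift_pow_comm hμ ξ hB'm]
    exact ih hB'm fun s hs => hf s (hB' hs)

/-- Iterating the one-step estimate would cost `4 ^ n`. Since `(∫ g dμ)ⁿ = ∫ gⁿ dμ` for simple `g`,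
the factor 4 is paid only once, as power boundedness requires. -/
theorem IsIntegral.seminorm_pow_le (hU : IsIntegral μ f U) (hμ : IsSpectralMeasure μ)
    (hμe : IsEquicontinuous μ) (hfb : ∃ C : ℝ, ∀ s, ‖f s‖ ≤ C)
    {D : Set S} (hD : MeasurableSet D) {r K : ℝ} (hr : 0 ≤ r)
    (hf : ∀ s ∈ D, ‖f s‖ ≤ r) {p : Seminorm ℂ F} (hp : Continuous p) {x : F}
    (hK : ∀ B, MeasurableSet B → p (μ B x) ≤ K) (n : ℕ) :
    p ((U ^ n) (μ D x)) ≤ 4 * r ^ n * K := by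
  obtain ⟨g, hgf, hg⟩ := hU
  obtain ⟨C, hC⟩ := hfb
  have hpow : ∀ y, Tendsto (fun k => (simpleIntegral μ (g k) ^ n) y) atTop (𝓝 ((U ^ n) y)) := by
    intro y
    induction n with
    | zero => simp
    | succ n ih =>
      have h1 : Tendsto (fun k => simpleIntegral μ (g k)
          ((simpleIntegral μ (g k) ^ n) y - (U ^ n) y)) atTop (𝓝 0) := by
        -- Strong limits pass to products because the approximating integrals are eventually
        -- equicontinuous, their integrands being bounded by `|C| + 1`.
        refine tendsto_of_forall_seminorm fun P hP => ?_
        obtain ⟨q, hq, hPq⟩ := hμe P hP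
        have h2 : Tendsto (fun k => 4 * (|C| + 1) *
            q ((simpleIntegral μ (g k) ^ n) y - (U ^ n) y)) atTop (𝓝 0) := by
          have h3 : Tendsto (fun k => (simpleIntegral μ (g k) ^ n) y - (U ^ n) y) atTop (𝓝 0) := by
            simpa using ih.sub_const ((U ^ n) y)
          simpa using ((hq.tendsto _).comp h3).const_mul (4 * (|C| + 1))
        refine squeeze_zero' (Eventually.of_forall fun _ => apply_nonneg _ _) ?_ h2
        filter_upwards [Metric.tendstoUniformly_iff.1 hgf 1 one_pos] with k hk
        rw [sub_zero]
        set z := (simpleIntegral μ (g k) ^ n) y - (U ^ n) y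
        have := hμ.seminorm_sum_fiber_le (g k) MeasurableSet.univ (fun c => c)
          (M := |C| + 1) (K := q z) (by positivity) (fun s _ => ?_) P (x := z)
          fun B _ hB => hPq B hB z
        · rwa [hμ.univ, ContinuousLinearMap.id_apply, ← simpleIntegral_apply] at this
        · have h1 := hk s
          rw [dist_comm, dist_eq_norm] at h1
          calc ‖g k s‖ = ‖f s + (g k s - f s)‖ := by congr 1; ring
            _ ≤ |C| + 1 := (norm_add_le _ _).trans
              (add_le_add ((hC s).trans (le_abs_self C)) h1.le)
      have h2 := h1.add (hg ((U ^ n) y))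
      simp only [map_sub, sub_add_cancel, zero_add] at h2
      simpa only [pow_succ', mul_apply_eq_comp] using h2
  have hlim : Tendsto (fun k => p ((simpleIntegral μ (g k) ^ n) (μ D x))) atTop
      (𝓝 (p ((U ^ n) (μ D x)))) := (hp.tendsto _).comp (hpow _)
  have hbound : ∀ δ > 0, p ((U ^ n) (μ D x)) ≤ 4 * (r + δ) ^ n * K := fun δ hδ => by
    refine le_of_tendsto hlim ?_
    filter_upwards [Metric.tendstoUniformly_iff.1 hgf δ hδ] with k hk
    rw [hμ.simpleIntegral_pow_apply]
    refine hμ.seminorm_sum_fiber_le (g k) hD (fun c => c ^ n) (by positivity) (fun s hs => ?_) p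
      fun B _ hB => hK B hB
    rw [norm_pow]
    refine pow_le_pow_left₀ (norm_nonneg _) ?_ n
    have h1 := hk s
    rw [dist_comm, dist_eq_norm] at h1
    calc ‖g k s‖ = ‖f s + (g k s - f s)‖ := by congr 1; ring
      _ ≤ r + δ := (norm_add_le _ _).trans (add_le_add (hf s hs) h1.le)
  have hlim2 : Tendsto (fun δ : ℝ => 4 * (r + δ) ^ n * K) (𝓝[>] 0) (𝓝 (4 * r ^ n * K)) := by
    have : Tendsto (fun δ : ℝ => 4 * (r + δ) ^ n * K) (𝓝 0) (𝓝 (4 * (r + 0) ^ n * K)) :=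
      Continuous.tendsto (by fun_prop) 0
    rw [add_zero] at this
    exact this.mono_left nhdsWithin_le_nhds
  refine ge_of_tendsto hlim2 ?_
  filter_upwards [self_mem_nhdsWithin] with δ hδ using hbound δ hδ

open scoped Classical in
/-- The signed measure `B ↦ Re φ(μ(f⁻¹ B) x)` on `ℂ`. -/
noncomputable def IsSpectralMeasure.reMeasure (hμ : IsSpectralMeasure μ) (hf : Measurable f)
    (φ : F →L[ℂ] ℂ) (x : F) : SignedMeasure ℂ where
  measureOf' B := if MeasurableSet B then (φ (μ (f ⁻¹' B) x)).re else 0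
  empty' := by simp [hμ.apply_empty]
  not_measurable' B hB := if_neg hB
  m_iUnion' G hG hd := by
    simp only [hG, MeasurableSet.iUnion hG, if_true, Set.preimage_iUnion]
    exact Complex.hasSum_re (hμ.weak_iUnion (fun n => f ⁻¹' G n) (fun n => hf (hG n))
      (fun i j hij => (hd hij).preimage f) x φ)

theorem IsSpectralMeasure.reMeasure_apply (hμ : IsSpectralMeasure μ) (hf : Measurable f)
    (φ : F →L[ℂ] ℂ) (x : F) {B : Set ℂ} (hB : MeasurableSet B) :
    hμ.reMeasure hf φ x B = (φ (μ (f ⁻¹' B) x)).re := if_pos hB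

/-- The exponent 3 is chosen to exceed the real dimension 2 of `ℂ`, so that the density at each
point of `A` is zero. -/
theorem IsIntegral.apply_preimage_eq_zero (hU : IsIntegral μ f U) (hμ : IsSpectralMeasure μ)
    (hμe : IsEquicontinuous μ) (hf : Measurable f) (hfb : ∃ C : ℝ, ∀ s, ‖f s‖ ≤ C)
    (φ : F →L[ℂ] ℂ) {A : Set ℂ} (hA : MeasurableSet A)
    (h : ∀ ξ ∈ A, ∃ q : Seminorm ℂ F, Continuous q ∧ ∀ y, ‖φ y‖ ≤ q ((shift U ξ ^ 3) y)) (x : F) :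
    φ (μ (f ⁻¹' A) x) = 0 := by
  obtain ⟨C, hC⟩ := hfb
  -- Boundedness of `f` reduces to a set of finite area.
  have hA' : f ⁻¹' A = f ⁻¹' (A ∩ Metric.closedBall 0 C) := by
    ext s
    simp [hC s]
  have hm : MeasurableSet (A ∩ Metric.closedBall 0 C) := hA.inter measurableSet_closedBall
  have key : ∀ x, (φ (μ (f ⁻¹' A) x)).re = 0 := by
    intro x
    rw [hA', ← hμ.reMeasure_apply hf φ x hm]
    refine signedMeasure_eq_zero_of_density _ hm
      (measure_ne_top_of_subset Set.inter_subset_right measure_closedBall_lt_top.ne) ?_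
    intro ξ hξ
    obtain ⟨q, hq, hφq⟩ := h ξ hξ.1
    obtain ⟨q', -, hqq'⟩ := hμe q hq
    refine ⟨4 ^ 3 * q' x, fun ε hε B hB hBm => ?_⟩
    rw [hμ.reMeasure_apply hf φ x hBm]
    refine (Complex.abs_re_le_norm _).trans ((hφq _).trans ?_)
    have := hU.seminorm_shift_pow_le hμ hε.le hq (fun B hB => hqq' B hB x) 3 (hf hBm)
      fun s hs => by simpa [dist_eq_norm, norm_sub_rev] using hB hs
    linarith
  refine Complex.ext (key x) ?_
  -- The real part at `-i x` is the imaginary part at `x`.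
  have := key (-Complex.I • x)
  simpa using this

end SpectralMeasure

end ScalarType

namespace ScalarType

/-! ### Ergodic averages -/

section Ergodic

variable {F : Type*} [AddCommGroup F] [Module ℂ F] [TopologicalSpace F]
  [IsTopologicalAddGroup F] [ContinuousSMul ℂ F]

theorem average_apply (U : F →L[ℂ] F) (lam : ℂ) (n : ℕ) (x : F) :
    average U lam n x = (n : ℂ)⁻¹ • ∑ k ∈ Finset.Icc 1 n, (lam ^ k)⁻¹ • (U ^ k) x := by
  simp [average]

theorem mem_ker_shift {U : F →L[ℂ] F} {lam : ℂ} {x : F} :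
    x ∈ (shift U lam).ker ↔ U x = lam • x := by
  rw [LinearMap.mem_ker, ContinuousLinearMap.coe_coe, shift_apply, sub_eq_zero, eq_comm]

theorem average_apply_of_mem_ker {U : F →L[ℂ] F} {lam : ℂ} (hlam : lam ≠ 0) {x : F}
    (hx : x ∈ (shift U lam).ker) {n : ℕ} (hn : n ≠ 0) : average U lam n x = x := by
  rw [mem_ker_shift] at hx
  have h : ∀ k, (U ^ k) x = lam ^ k • x := fun k => by
    induction k with
    | zero => simp
    | succ k ih => rw [pow_succ', mul_apply_eq_comp, ih, map_smul, hx, smul_smul, pow_succ]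
  rw [average_apply, Finset.sum_congr rfl fun k _ => by
    rw [h, smul_smul, inv_mul_cancel₀ (pow_ne_zero k hlam), one_smul]]
  have hn' : (n : ℂ) ≠ 0 := by exact_mod_cast hn
  rw [Finset.sum_const, Nat.card_Icc, add_tsub_cancel_right, ← Nat.cast_smul_eq_nsmul ℂ, smul_smul,
    inv_mul_cancel₀ hn', one_smul]

/-- The sum telescopes, leaving two terms that stay bounded before division by `n` when `λ⁻¹U` is
power bounded. -/
theorem average_apply_shift {U : F →L[ℂ] F} {lam : ℂ} (hlam : lam ≠ 0) (y : F) (n : ℕ) :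
    average U lam n (shift U lam y) = (n : ℂ)⁻¹ • (U y - (lam ^ n)⁻¹ • (U ^ (n + 1)) y) := by
  rw [average_apply]
  congr 1
  induction n with
  | zero => simp
  | succ n ih =>
    rw [Finset.sum_Icc_succ_top (by omega), ih, shift_apply, map_sub, map_smul, smul_sub, smul_smul,
      ← mul_apply_eq_comp, ← pow_succ U (n + 1)]
    have : (lam ^ (n + 1))⁻¹ * lam = (lam ^ n)⁻¹ := by
      field_simp
      ring
    rw [this]
    abel

theorem seminorm_average_le {U : F →L[ℂ] F} {lam : ℂ} (hlam : lam ≠ 0) (p : Seminorm ℂ F)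
    {x : F} {K : ℝ} (h : ∀ n, p ((U ^ n) x) ≤ ‖lam‖ ^ n * K) (n : ℕ) :
    p (average U lam n x) ≤ K := by
  have hK : 0 ≤ K := by simpa using (apply_nonneg p _).trans (h 0)
  have hl : 0 < ‖lam‖ := norm_pos_iff.2 hlam
  rcases eq_or_ne n 0 with rfl | hn
  · simpa [average_apply] using hK
  rw [average_apply, map_smul_eq_mul, norm_inv, Complex.norm_natCast,
    inv_mul_le_iff₀ (by positivity)]
  have h1 : ∀ s : Finset ℕ, p (∑ k ∈ s, (lam ^ k)⁻¹ • (U ^ k) x) ≤ s.card * K := fun s => by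
    rw [← nsmul_eq_mul]
    refine (Finset.le_sum_of_subadditive p (map_zero p).le (map_add_le_add p) _ _).trans
      (Finset.sum_le_card_nsmul _ _ _ fun k _ => ?_)
    rw [map_smul_eq_mul, norm_inv, norm_pow, inv_mul_le_iff₀ (by positivity)]
    exact h k
  simpa using h1 (Finset.Icc 1 n)

/-- The mean ergodic theorem on the closure of the image of `λ I - U`, for power bounded
`λ⁻¹ U`. -/
theorem tendsto_average_of_mem_closure [LocallyConvexSpace ℝ F] {U : F →L[ℂ] F} {lam : ℂ}
    (hlam : lam ≠ 0)
    (h : ∀ p : Seminorm ℂ F, Continuous p → ∃ q : Seminorm ℂ F, Continuous q ∧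
      ∀ n x, p ((U ^ n) x) ≤ ‖lam‖ ^ n * q x)
    {z : F} (hz : z ∈ (shift U lam).range.topologicalClosure) :
    Tendsto (fun n => average U lam n z) atTop (𝓝 0) := by
  have hl : 0 < ‖lam‖ := norm_pos_iff.2 hlam
  refine tendsto_of_forall_seminorm fun p hp => ?_
  obtain ⟨q, hq, hpq⟩ := h p hp
  simp only [sub_zero]
  refine Metric.tendsto_atTop.2 fun ε hε => ?_
  have hz' : z ∈ closure ((shift U lam).range : Set F) := hz
  obtain ⟨w, hw, y, rfl⟩ := mem_closure_iff_nhds.1 hz' {w | q (z - w) < ε / 2}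
    ((isOpen_lt (hq.comp (continuous_const.sub continuous_id)) continuous_const).mem_nhds
      (by simpa using hε))
  have hw' : q (z - shift U lam y) < ε / 2 := hw
  have hlim : Tendsto (fun n : ℕ => (n : ℝ)⁻¹ * (2 * (‖lam‖ * q y))) atTop (𝓝 0) := by
    simpa using (tendsto_inv_atTop_nhds_zero_nat (𝕜 := ℝ)).mul_const (2 * (‖lam‖ * q y))
  obtain ⟨N, hN⟩ := eventually_atTop.1 (hlim.eventually_lt_const (half_pos hε))
  refine ⟨N, fun n hn => ?_⟩
  rw [Real.dist_0_eq_abs, abs_of_nonneg (apply_nonneg _ _)]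
  have e1 : p (average U lam n (z - shift U lam y)) ≤ q (z - shift U lam y) :=
    seminorm_average_le hlam p (fun n => hpq n _) n
  have e2 : p (average U lam n (shift U lam y)) ≤ (n : ℝ)⁻¹ * (2 * (‖lam‖ * q y)) := by
    rw [average_apply_shift hlam, map_smul_eq_mul, norm_inv, Complex.norm_natCast]
    refine mul_le_mul_of_nonneg_left ?_ (by positivity)
    refine (map_sub_le_add p _ _).trans ?_
    rw [map_smul_eq_mul, norm_inv, norm_pow]
    have h1 := hpq 1 y
    rw [pow_one, pow_one] at h1
    have h2 : (‖lam‖ ^ n)⁻¹ * p ((U ^ (n + 1)) y) ≤ ‖lam‖ * q y := by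
      rw [inv_mul_le_iff₀ (by positivity), ← mul_assoc, ← pow_succ]
      exact hpq _ _
    linarith
  calc p (average U lam n z)
      = p (average U lam n (z - shift U lam y) + average U lam n (shift U lam y)) := by
        rw [← map_add, sub_add_cancel]
    _ ≤ _ := map_add_le_add p _ _
    _ < ε := by linarith [hN n hn]

end Ergodic

section DualSeminorm

variable {F : Type*} [AddCommGroup F] [Module ℂ F] [TopologicalSpace F]

/-- The seminorm `x ↦ |φ x|`. -/
noncomputable def dualSeminorm (φ : F →L[ℂ] ℂ) : Seminorm ℂ F := (normSeminorm ℂ ℂ).comp φ.toLinearMap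

theorem dualSeminorm_apply (φ : F →L[ℂ] ℂ) (x : F) : dualSeminorm φ x = ‖φ x‖ := rfl

theorem continuous_dualSeminorm (φ : F →L[ℂ] ℂ) : Continuous (dualSeminorm φ) :=
  φ.continuous.norm

end DualSeminorm

/-! ### Support of the spectral measure and power boundedness -/

section Spectral

variable {S F : Type*} [MeasurableSpace S] [AddCommGroup F] [Module ℂ F] [TopologicalSpace F]
  [IsTopologicalAddGroup F] [ContinuousSMul ℂ F] [LocallyConvexSpace ℝ F] [T2Space F]
  {μ : Set S → F →L[ℂ] F} {f : S → ℂ} {U : F →L[ℂ] F}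

/-- The spectral measure vanishes on Borel subsets of the resolvent set. -/
theorem IsIntegral.imageMeasure_eq_zero_of_subset_resolventSet (hU : IsIntegral μ f U)
    (hμ : IsSpectralMeasure μ) (hμe : IsEquicontinuous μ) (hf : Measurable f)
    (hfb : ∃ C : ℝ, ∀ s, ‖f s‖ ≤ C) {A : Set ℂ} (hA : MeasurableSet A)
    (hAU : A ⊆ resolventSet U) : imageMeasure μ f A = 0 := by
  ext x
  refine eq_zero_of_forall_dual fun φ => ?_
  refine hU.apply_preimage_eq_zero hμ hμe hf hfb φ hA (fun ξ hξ => ?_) x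
  have hind : IsInducing (shift U ξ) := (hAU hξ).2.isInducing
  obtain ⟨q₁, h₁, k₁⟩ := exists_seminorm_le_comp_of_isInducing hind (continuous_dualSeminorm φ)
  obtain ⟨q₂, h₂, k₂⟩ := exists_seminorm_le_comp_of_isInducing hind h₁
  obtain ⟨q₃, h₃, k₃⟩ := exists_seminorm_le_comp_of_isInducing hind h₂
  exact ⟨q₃, h₃, fun y => (k₁ y).trans ((k₂ _).trans (k₃ _))⟩

/-- If `φ` kills `Im(λI - U)`, then `φ ∘ (ξI - U)³ = (ξ - λ)³ φ`, so `φ` is dominated at every `ξ ≠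
λ` and the vanishing principle applies on `{λ}ᶜ`. -/
theorem IsIntegral.imageMeasure_compl_apply_mem_closure (hU : IsIntegral μ f U)
    (hμ : IsSpectralMeasure μ) (hμe : IsEquicontinuous μ) (hf : Measurable f)
    (hfb : ∃ C : ℝ, ∀ s, ‖f s‖ ≤ C) (lam : ℂ) (x : F) :
    imageMeasure μ f {lam}ᶜ x ∈ (shift U lam).range.topologicalClosure := by
  refine mem_topologicalClosure_of_forall_dual fun φ hφ => ?_
  refine hU.apply_preimage_eq_zero hμ hμe hf hfb φ (measurableSet_singleton lam).compl
    (fun ξ hξ => ?_) x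
  have hne : ξ - lam ≠ 0 := sub_ne_zero.2 hξ
  have h1 : ∀ y, φ (shift U ξ y) = (ξ - lam) * φ y := fun y => by
    have h2 := hφ (shift U lam y) ⟨y, rfl⟩
    rw [shift_apply, map_sub, map_smul, smul_eq_mul] at h2 ⊢
    linear_combination h2
  have h3 : ∀ y, φ ((shift U ξ ^ 3) y) = (ξ - lam) ^ 3 * φ y := fun y => by
    change φ (shift U ξ (shift U ξ (shift U ξ y))) = _
    rw [h1, h1, h1]
    ring
  refine ⟨dualSeminorm (((ξ - lam) ^ 3)⁻¹ • φ), continuous_dualSeminorm _, fun y => ?_⟩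
  rw [dualSeminorm_apply, smul_apply, h3, smul_eq_mul,
    inv_mul_cancel_left₀ (pow_ne_zero 3 hne)]

theorem IsIntegral.range_imageMeasure_le_ker (hU : IsIntegral μ f U) (hμ : IsSpectralMeasure μ)
    (hμe : IsEquicontinuous μ) (hf : Measurable f) (lam : ℂ) (x : F) :
    imageMeasure μ f {lam} x ∈ (shift U lam).ker := by
  refine LinearMap.mem_ker.2 (eq_zero_of_forall_seminorm fun p hp => ?_)
  obtain ⟨q, -, hpq⟩ := hμe p hp
  refine le_antisymm ?_ (apply_nonneg p _)
  -- The estimate is used with `ε = 0`, since `f = λ` on this set.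
  have := hU.seminorm_shift_le hμ (hf (measurableSet_singleton lam)) (ξ := lam) le_rfl
    (fun s hs => by
      have hs' : f s = lam := hs
      simp [hs']) hp (x := x) fun B _ hB => hpq B hB x
  rwa [mul_zero, zero_mul] at this

/-- As `|λ|` is the spectral radius, points outside the disc `|z| ≤ |λ|` are resolvent points and
carry no spectral mass; so `f` may be treated as bounded by `|λ|`. -/
theorem IsIntegral.seminorm_pow_le_of_mem_peripheralSpectrum (hU : IsIntegral μ f U)
    (hμ : IsSpectralMeasure μ) (hμe : IsEquicontinuous μ) (hf : Measurable f)
    (hfb : ∃ C : ℝ, ∀ s, ‖f s‖ ≤ C) {lam : ℂ} (hlam : lam ∈ peripheralSpectrum U)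
    (p : Seminorm ℂ F) (hp : Continuous p) :
    ∃ q : Seminorm ℂ F, Continuous q ∧ ∀ n x, p ((U ^ n) x) ≤ ‖lam‖ ^ n * q x := by
  obtain ⟨q, hq, hpq⟩ := hμe p hp
  refine ⟨(4 : ℝ≥0) • q, hq.const_smul _, fun n x => ?_⟩
  have hball : MeasurableSet (Metric.closedBall (0 : ℂ) ‖lam‖) := measurableSet_closedBall
  have h0 : imageMeasure μ f (Metric.closedBall 0 ‖lam‖)ᶜ = 0 := by
    refine hU.imageMeasure_eq_zero_of_subset_resolventSet hμ hμe hf hfb hball.compl fun ξ hξ => ?_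
    by_contra hres
    have h1 : ‖ξ‖ₑ ≤ ‖lam‖ₑ := hlam.2 ▸ le_iSup₂ (f := fun z (_ : z ∈ spectrum U) => ‖z‖ₑ) ξ hres
    rw [enorm_le_iff_norm_le] at h1
    exact hξ (by simpa using h1)
  have h1 : μ (f ⁻¹' Metric.closedBall 0 ‖lam‖) x = x := by
    have h2 := hμ.apply_union (hf hball) (hf hball.compl) (disjoint_compl_right.preimage f)
    rw [← Set.preimage_union, Set.union_compl_self, Set.preimage_univ, hμ.univ] at h2
    have h3 := congrArg (fun T : F →L[ℂ] F => T x) h2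
    have h4 : μ (f ⁻¹' (Metric.closedBall 0 ‖lam‖)ᶜ) x = 0 :=
      congrArg (fun T : F →L[ℂ] F => T x) h0
    simp only [add_apply, ContinuousLinearMap.id_apply, h4, add_zero] at h3
    exact h3.symm
  have h2 := hU.seminorm_pow_le hμ hμe hfb (hf hball) (norm_nonneg lam)
    (fun s hs => by simpa using hs) hp (x := x) (fun B hB => hpq B hB x) n
  rw [h1] at h2
  change _ ≤ ‖lam‖ ^ n * (4 * q x)
  linarith

end Spectral

end ScalarType

theorem mainTheorem3
    {F : Type*} [AddCommGroup F] [Module ℂ F] [TopologicalSpace F]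
    [IsTopologicalAddGroup F] [ContinuousSMul ℂ F] [LocallyConvexSpace ℝ F] [T2Space F]
    [TopologicalSpace.SeparableSpace F]
    (hF : ScalarType.LocallySeqWeaklyCompact F)
    {S : Type*} [MeasurableSpace S] (μ : Set S → F →L[ℂ] F)
    (hμ : ScalarType.IsSpectralMeasure μ) (hμe : ScalarType.IsEquicontinuous μ)
    (f : S → ℂ) (hf : Measurable f) (hfb : ∃ C : ℝ, ∀ s, ‖f s‖ ≤ C)
    (U : F →L[ℂ] F) (hU : ScalarType.IsIntegral μ f U)
    (lam : ℂ) (hlam0 : lam ≠ 0)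
    (hlam : lam ∈ ScalarType.peripheralSpectrum U) (hlamp : lam ∈ ScalarType.pointSpectrum U) :
    (∀ ψ : F, Tendsto (fun n : ℕ => ScalarType.average U lam n ψ) atTop
        (𝓝 (ScalarType.imageMeasure μ f {lam} ψ))) ∧
      IsIdempotentElem (ScalarType.imageMeasure μ f {lam}) ∧
      (ScalarType.imageMeasure μ f {lam}).range = (ScalarType.shift U lam).ker ∧
      Commute (ScalarType.imageMeasure μ f {lam}) U ∧
      IsCompl (ScalarType.shift U lam).ker (ScalarType.shift U lam).range.topologicalClosure := by
  set P := ScalarType.imageMeasure μ f {lam} with hP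
  have hm : MeasurableSet ({lam} : Set ℂ) := measurableSet_singleton lam
  have hker : ∀ x, P x ∈ (ScalarType.shift U lam).ker :=
    hU.range_imageMeasure_le_ker hμ hμe hf lam
  have hcl := hU.imageMeasure_compl_apply_mem_closure hμ hμe hf hfb lam
  have hadd : ∀ x, P x + ScalarType.imageMeasure μ f {lam}ᶜ x = x := fun x => by
    have h2 := hμ.apply_union (hf hm) (hf hm.compl) (disjoint_compl_right.preimage f)
    rw [← Set.preimage_union, Set.union_compl_self, Set.preimage_univ, hμ.univ] at h2
    exact (congrArg (fun T : F →L[ℂ] F => T x) h2).symm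
  have hzero : ∀ z ∈ (ScalarType.shift U lam).range.topologicalClosure,
      Tendsto (fun n => ScalarType.average U lam n z) atTop (𝓝 0) := fun z hz =>
    ScalarType.tendsto_average_of_mem_closure hlam0
      (hU.seminorm_pow_le_of_mem_peripheralSpectrum hμ hμe hf hfb hlam) hz
  have hfix : ∀ x ∈ (ScalarType.shift U lam).ker,
      Tendsto (fun n => ScalarType.average U lam n x) atTop (𝓝 x) := fun x hx =>
    tendsto_const_nhds.congr' (by
      filter_upwards [eventually_ne_atTop 0] with n hn
      exact (ScalarType.average_apply_of_mem_ker hlam0 hx hn).symm)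
  have hlim : ∀ x, Tendsto (fun n => ScalarType.average U lam n x) atTop (𝓝 (P x)) := fun x => by
    have h := (hfix _ (hker x)).add (hzero _ (hcl x))
    simpa only [← map_add, hadd, add_zero] using h
  refine ⟨hlim, ?_, ?_, ?_, ?_, ?_⟩
  · ext x
    exact (hμ.apply_apply (hf hm) (hf hm) x).trans (by rw [Set.inter_self]; rfl)
  · refine le_antisymm ?_ fun x hx => ⟨x, tendsto_nhds_unique (hlim x) (hfix x hx)⟩
    rintro _ ⟨x, rfl⟩
    exact hker x
  · ext x
    exact (hU.comm hμ (hf hm) x).symm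
  -- On the intersection the averages tend both to `x` and to 0.
  · exact Submodule.disjoint_def.2 fun x hx hx' => tendsto_nhds_unique (hfix x hx) (hzero x hx')
  · refine codisjoint_iff.2 (eq_top_iff.2 fun x _ => ?_)
    exact Submodule.mem_sup.2 ⟨_, hker x, _, hcl x, hadd x⟩
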